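/- Let $\ell\in\mathbb N$ and let $H^1=(H^1_s)_{s\in\mathbb R^2}$ be an $\mathbb R^\ell$-valued stochastic process on a probability space $(\Omega,\mathcal A,\mathbb P)$ that is Gaussian (all its finite-dimensional distributions are multivariate normal, possibly degenerate) and stationary (its finite-dimensional distributions are invariant under translations of $\mathbb R^2$). Let $C:\mathbb R^2\to\mathbb R^{\ell\times\ell}$ be its covariance function, i.e. $C(h)=\operatorname{Cov}(H^1_s,H^1_{s+h})$ for all $s,h\in\mathbb R^2$, and assume that $C(h)\to 0$ entrywise as $\|h\|_2\to\infty$. Let $m\ge 1$, let $s^1_1<s^1_2<\cdots$ be an equally spaced sequence of real numbers, let $s^2_1,\dots,s^2_m\in\mathbb R$, and define the sequence of locations $(s_n)_{n\in\mathbb N}$ in $\mathbb R^2$ by $s_{(i-1)m+j}=(s^1_i,s^2_j)$ for all $i\in\mathbb N=\{1,2,\dots\}$ and $j\in\{1,\dots,m\}$. Then, for every measurable function $\varphi:\mathbb R^\ell\to\mathbb R$ with $\mathbb E[|\varphi(H^1_0)|]<\infty$, $$\frac1n\sum_{i=1}^n\varphi(H^1_{s_i})\;\longrightarrow\;\mathbb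 E[\varphi(H^1_0)]\qquad\text{in probability as } n\to\infty .$$ -/

import Mathlib

open MeasureTheory ProbabilityTheory Filter Topology

/-- A (spatial) process `H`, indexed by the plane, is (strictly) stationary under `P` if all its
finite-dimensional distributions are invariant under translations of the plane. -/
def IsStationaryField {Ω E : Type*} [MeasurableSpace Ω] [MeasurableSpace E]
    (H : EuclideanSpace ℝ (Fin 2) → Ω → E) (P : Measure Ω) : Prop :=
  ∀ (h : EuclideanSpace ℝ (Fin 2)) (I : Finset (EuclideanSpace ℝ (Fin 2))),
    P.map (fun ω (s : I) => H (s + h) ω) = P.map (fun ω (s : I) => H s ω)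

/-- `C` is the (matrix-valued) covariance function of the `ℝ^ℓ`-valued spatial process `H`:
`C h = Cov(H_s, H_{s+h})` for all locations `s` and all lags `h`. -/
def IsCovarianceFunction {Ω : Type*} [MeasurableSpace Ω] {ℓ : ℕ}
    (H : EuclideanSpace ℝ (Fin 2) → Ω → EuclideanSpace ℝ (Fin ℓ)) (P : Measure Ω)
    (C : EuclideanSpace ℝ (Fin 2) → Matrix (Fin ℓ) (Fin ℓ) ℝ) : Prop :=
  ∀ (s h : EuclideanSpace ℝ (Fin 2)) (i j : Fin ℓ),
    C h i j = covariance (fun ω => H s ω i) (fun ω => H (s + h) ω j) P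

/-- `s` enumerates, column by column, the regular grid with first coordinates
`x 0 < x 1 < ⋯` (equally spaced) and the `m ≥ 1` second coordinates `y 0, …, y (m - 1)`.
Indices start at `0`, so that the location with index `i * m + j` is `(x i, y j)`. -/
structure IsRegularGridSampling (m : ℕ) (x : ℕ → ℝ) (y : Fin m → ℝ)
    (s : ℕ → EuclideanSpace ℝ (Fin 2)) : Prop where
  rows_pos : 0 < m
  strictMono : StrictMono x
  equally_spaced : ∃ Δ : ℝ, ∀ i, x (i + 1) - x i = Δ
  loc_eq : ∀ (i : ℕ) (j : Fin m), s (i * m + j) = !₂[x i, y j]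

/-- The weak law of large numbers for the process `H` sampled along the locations `s`:
for every measurable `φ` with `E|φ(H_0)| < ∞`, the averages of `φ(H_{s_i})` over the first `n`
locations converge in probability to `E[φ(H_0)]`. -/
def SatisfiesLLN {Ω E : Type*} [MeasurableSpace Ω] [MeasurableSpace E]
    (H : EuclideanSpace ℝ (Fin 2) → Ω → E) (s : ℕ → EuclideanSpace ℝ (Fin 2))
    (P : Measure Ω) : Prop :=
  ∀ φ : E → ℝ, Measurable φ → Integrable (fun ω => φ (H 0 ω)) P →
    TendstoInMeasure P
      (fun (n : ℕ) ω => (1 / (n : ℝ)) * ∑ i ∈ Finset.range n, φ (H (s i) ω))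
      atTop (fun _ => ∫ ω, φ (H 0 ω) ∂P)

/-! For Gaussian pairs, vanishing cross-covariance means asymptotic independence: the joint
characteristic function is the product of the marginal ones times the exponential of minus a
covariance. With the marginal law fixed by stationarity, Lévy's continuity theorem gives
decorrelation of `g (H p)` and `g (H q)` for bounded continuous `g` as `‖q - p‖ → ∞`. Along the
grid, a large index gap forces a large distance, so the second moment of the centred average of `g`
tends to 0: only a band of O(n) of its n² terms is not small. An integrable `φ` need not be square
integrable, so it is approximated by such `g` in L¹ of the marginal law; the error in the averages
is uniform in `n`. -/

lemma IsStationaryField.map_eq {Ω E : Type*} [MeasurableSpace Ω] [MeasurableSpace E]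
    {H : EuclideanSpace ℝ (Fin 2) → Ω → E} {P : Measure Ω} (hH : IsStationaryField H P)
    (hm : ∀ s, AEMeasurable (H s) P) (s : EuclideanSpace ℝ (Fin 2)) :
    P.map (H s) = P.map (H 0) := by
  have h := congrArg (Measure.map fun f => f ⟨0, Finset.mem_singleton_self 0⟩) (hH s {0})
  rw [AEMeasurable.map_map_of_aemeasurable (measurable_pi_apply _).aemeasurable
      (aemeasurable_pi_lambda _ fun t => hm _),
    AEMeasurable.map_map_of_aemeasurable (measurable_pi_apply _).aemeasurable
      (aemeasurable_pi_lambda _ fun t => hm _)] at h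
  simpa [Function.comp_def] using h

/-- The first coordinate advances by `Δ > 0` every `m` indices, and it alone forces the separation.
-/
lemma IsRegularGridSampling.exists_lag_le_norm_sub {m : ℕ} {x : ℕ → ℝ} {y : Fin m → ℝ}
    {s : ℕ → EuclideanSpace ℝ (Fin 2)} (hs : IsRegularGridSampling m x y s) (R : ℝ) :
    ∃ N : ℕ, ∀ k l, k + N ≤ l → R ≤ ‖s l - s k‖ := by
  have hm := hs.rows_pos
  obtain ⟨Δ, hΔ⟩ := hs.equally_spaced
  have hpos : 0 < Δ := by
    have := hs.strictMono (Nat.lt_succ_self 0)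
    have := hΔ 0
    linarith
  have hx (i : ℕ) (d : ℕ) : x (i + d) - x i = d * Δ := by
    induction d with
    | zero => simp
    | succ d ih =>
      have := hΔ (i + d)
      rw [← add_assoc]
      push_cast
      linarith
  have hloc (k : ℕ) : s k 0 = x (k / m) := by
    have := hs.loc_eq (k / m) ⟨k % m, Nat.mod_lt _ hm⟩
    rw [Nat.div_add_mod'] at this
    simp [this]
  obtain ⟨K, hK⟩ := exists_nat_ge (R / Δ)
  refine ⟨K * m, fun k l hkl => ?_⟩
  have hdiv : k / m + K ≤ l / m := by
    rw [← Nat.add_mul_div_right k K hm]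
    exact Nat.div_le_div_right hkl
  obtain ⟨d, hd⟩ := Nat.exists_eq_add_of_le hdiv
  calc R ≤ K * Δ := (div_le_iff₀ hpos).1 hK
    _ ≤ ((K + d : ℕ) : ℝ) * Δ := by gcongr; omega
    _ = (s l - s k) 0 := by
      rw [PiLp.sub_apply, hloc, hloc, hd, add_assoc, hx]
    _ ≤ ‖(s l - s k) 0‖ := Real.le_norm_self _
    _ ≤ ‖s l - s k‖ := PiLp.norm_apply_le _ _

/-! ### The second-moment method. -/

/-- A weak law of large numbers for uniformly bounded random variables whose mixed moments
become small at large lags. -/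
lemma tendsto_eLpNorm_one_average_of_integral_mul_le {Ω : Type*} [MeasurableSpace Ω]
    {P : Measure Ω} [IsProbabilityMeasure P] {X : ℕ → Ω → ℝ}
    (hX : ∀ k, AEStronglyMeasurable (X k) P) {B : ℝ} (hB : ∀ k ω, |X k ω| ≤ B)
    (hlag : ∀ ε > 0, ∃ N : ℕ, ∀ k l, k + N ≤ l → |∫ ω, X k ω * X l ω ∂P| ≤ ε) :
    Tendsto (fun n : ℕ => eLpNorm (fun ω => (1 / (n : ℝ)) * ∑ i ∈ Finset.range n, X i ω) 1 P)
      atTop (𝓝 0) := by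
  have hB0 : 0 ≤ B := by
    obtain ⟨ω⟩ : Nonempty Ω := P.nonempty_of_neZero
    exact (abs_nonneg _).trans (hB 0 ω)
  have hmem (k : ℕ) : MemLp (X k) 2 P :=
    MemLp.of_bound (hX k) B (ae_of_all _ fun ω => by simpa using hB k ω)
  have hmul (k l : ℕ) : Integrable (fun ω => X k ω * X l ω) P := (hmem k).integrable_mul (hmem l)
  have hbound (k l : ℕ) : |∫ ω, X k ω * X l ω ∂P| ≤ B ^ 2 := by
    have := norm_integral_le_of_norm_le_const (μ := P) (f := fun ω => X k ω * X l ω) (C := B ^ 2)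
      (ae_of_all _ fun ω => by
        rw [norm_mul, sq]
        exact mul_le_mul (hB k ω) (hB l ω) (norm_nonneg _) hB0)
    simpa using this
  have hsq (n : ℕ) : ∫ ω, ((1 / (n : ℝ)) * ∑ i ∈ Finset.range n, X i ω) ^ 2 ∂P
      = (1 / (n : ℝ)) ^ 2 * ∑ k ∈ Finset.range n, ∑ l ∈ Finset.range n,
        ∫ ω, X k ω * X l ω ∂P := by
    simp_rw [mul_pow, integral_const_mul, sq (∑ i ∈ Finset.range n, X i _), Finset.sum_mul_sum]
    rw [integral_finsetSum _ fun k _ => integrable_finsetSum _ fun l _ => hmul k l]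
    congr 1
    exact Finset.sum_congr rfl fun k _ => integral_finsetSum _ fun l _ => hmul k l
  have hlim : Tendsto (fun n : ℕ => ∫ ω, ((1 / (n : ℝ)) * ∑ i ∈ Finset.range n, X i ω) ^ 2 ∂P)
      atTop (𝓝 0) := by
    rw [Metric.tendsto_atTop]
    intro ε hε
    obtain ⟨N, hN⟩ := hlag (ε / 2) (half_pos hε)
    -- Chosen so that a row's near-diagonal terms, at most `2 * N` of size `B ^ 2`, total less than
    -- `n * (ε / 2)`.
    obtain ⟨n₀, hn₀⟩ := exists_nat_gt (2 * N * B ^ 2 / (ε / 2))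
    refine ⟨n₀ + 1, fun n hn => ?_⟩
    have hnpos : (0 : ℝ) < n := by exact_mod_cast (by omega : 0 < n)
    -- The interval is the band `|k - l| < N`; truncated subtraction at 0 is harmless.
    have hterm (k l : ℕ) : |∫ ω, X k ω * X l ω ∂P| ≤
        ε / 2 + if l ∈ Finset.Ico (k + 1 - N) (k + N) then B ^ 2 else 0 := by
      split_ifs with h
      · linarith [hbound k l]
      · rw [add_zero]
        rw [Finset.mem_Ico] at h
        by_cases hkl : k + N ≤ l
        · exact hN k l hkl
        · simp_rw [mul_comm (X k _)]
          exact hN l k (by omega)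
    have hrow (k : ℕ) : ∑ l ∈ Finset.range n, |∫ ω, X k ω * X l ω ∂P| ≤
        n * (ε / 2) + 2 * N * B ^ 2 := by
      refine (Finset.sum_le_sum fun l _ => hterm k l).trans ?_
      rw [Finset.sum_add_distrib, Finset.sum_const, Finset.card_range, nsmul_eq_mul,
        ← Finset.sum_filter, Finset.sum_const, nsmul_eq_mul]
      gcongr
      have : (Finset.filter (fun l => l ∈ Finset.Ico (k + 1 - N) (k + N)) (Finset.range n)).card
          ≤ 2 * N := by
        refine (Finset.card_le_card (t := Finset.Ico (k + 1 - N) (k + N)) fun l hl =>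
          (Finset.mem_filter.1 hl).2).trans ?_
        rw [Nat.card_Ico]
        omega
      exact_mod_cast this
    have hn' : 2 * N * B ^ 2 < n * (ε / 2) := by
      have h1 : (n₀ : ℝ) < n := by exact_mod_cast hn
      exact (div_lt_iff₀ (half_pos hε)).1 (hn₀.trans h1)
    rw [Real.dist_eq, sub_zero, hsq, abs_mul, abs_of_nonneg (sq_nonneg (1 / (n : ℝ)))]
    calc (1 / (n : ℝ)) ^ 2 * |∑ k ∈ Finset.range n, ∑ l ∈ Finset.range n, ∫ ω, X k ω * X l ω ∂P|
        ≤ (1 / (n : ℝ)) ^ 2 * ∑ k ∈ Finset.range n, ∑ l ∈ Finset.range n,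
            |∫ ω, X k ω * X l ω ∂P| := by
          gcongr
          exact (Finset.abs_sum_le_sum_abs _ _).trans
            (Finset.sum_le_sum fun k _ => Finset.abs_sum_le_sum_abs _ _)
      _ ≤ (1 / (n : ℝ)) ^ 2 * (n * (n * (ε / 2) + 2 * N * B ^ 2)) := by
          gcongr
          refine (Finset.sum_le_sum fun k _ => hrow k).trans ?_
          simp [mul_add]
      _ < (1 / (n : ℝ)) ^ 2 * (n * (n * (ε / 2) + n * (ε / 2))) := by gcongr
      _ = ε := by field_simp; ring
  have hmean (n : ℕ) : MemLp (fun ω => (1 / (n : ℝ)) * ∑ i ∈ Finset.range n, X i ω) 2 P :=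
    (memLp_finsetSum _ fun i _ => hmem i).const_mul _
  have htwo : Tendsto (fun n : ℕ =>
      eLpNorm (fun ω => (1 / (n : ℝ)) * ∑ i ∈ Finset.range n, X i ω) 2 P) atTop (𝓝 0) := by
    have := ENNReal.tendsto_ofReal ((Real.continuous_sqrt.tendsto 0).comp hlim)
    rw [Real.sqrt_zero, ENNReal.ofReal_zero] at this
    refine this.congr fun n => ?_
    rw [(hmean n).eLpNorm_eq_integral_rpow_norm two_ne_zero ENNReal.ofNat_ne_top]
    simp only [Function.comp_apply, Real.sqrt_eq_rpow, ENNReal.toReal_ofNat, Real.rpow_ofNat,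
      Real.norm_eq_abs, sq_abs, one_div]
  exact tendsto_of_tendsto_of_tendsto_of_le_of_le tendsto_const_nhds htwo (fun n => zero_le)
    fun n => eLpNorm_le_eLpNorm_of_exponent_le one_le_two (hmean n).1

/-! ### Gaussian decorrelation and bounded observables. -/

open scoped RealInnerProductSpace in
/-- The characteristic function of a Gaussian pair is the product of the marginal characteristic
functions, corrected by the exponential of the cross-covariance. -/
lemma ProbabilityTheory.HasGaussianLaw.charFun_map_toLp_prodMk {Ω E F : Type*} [MeasurableSpace Ω]
    {P : Measure Ω} [NormedAddCommGroup E] [InnerProductSpace ℝ E] [MeasurableSpace E]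
    [BorelSpace E] [SecondCountableTopology E] [CompleteSpace E]
    [NormedAddCommGroup F] [InnerProductSpace ℝ F] [MeasurableSpace F]
    [BorelSpace F] [SecondCountableTopology F] [CompleteSpace F] {X : Ω → E} {Y : Ω → F}
    (hXY : HasGaussianLaw (fun ω => (X ω, Y ω)) P) (t : WithLp 2 (E × F)) :
    charFun (P.map fun ω => WithLp.toLp 2 (X ω, Y ω)) t =
      charFun (P.map X) t.fst * charFun (P.map Y) t.snd *
        Complex.exp (-(cov[fun ω => ⟪t.fst, X ω⟫, fun ω => ⟪t.snd, Y ω⟫; P] : ℝ)) := by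
  have := hXY.isProbabilityMeasure
  have hX : MemLp (fun ω => ⟪t.fst, X ω⟫) 2 P := hXY.fst.memLp_two.const_inner _
  have hY : MemLp (fun ω => ⟪t.snd, Y ω⟫) 2 P := hXY.snd.memLp_two.const_inner _
  rw [(hXY.toLp_prodMk 2).charFun_map_eq, hXY.fst.charFun_map_eq, hXY.snd.charFun_map_eq]
  have hfst : t.ofLp.1 = t.fst := rfl
  have hsnd : t.ofLp.2 = t.snd := rfl
  simp only [WithLp.prod_inner_apply, hfst, hsnd]
  -- The 2 in the variance of a sum cancels the 1/2 in the Gaussian exponent.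
  rw [variance_fun_add hX hY,
    integral_add (hX.integrable one_le_two) (hY.integrable one_le_two), ← Complex.exp_add,
    ← Complex.exp_add]
  congr 1
  push_cast
  ring

open scoped RealInnerProductSpace BoundedContinuousFunction in
/-- Jointly Gaussian pairs with fixed marginals are asymptotically independent as soon as their
cross-covariances vanish in the limit. -/
lemma tendsto_integral_mul_of_hasGaussianLaw {Ω E : Type*} [MeasurableSpace Ω]
    {P : Measure Ω} [NormedAddCommGroup E] [InnerProductSpace ℝ E] [FiniteDimensional ℝ E]
    [MeasurableSpace E] [BorelSpace E] {μ ν : Measure E} {X Y : ℕ → Ω → E}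
    (hXY : ∀ n, HasGaussianLaw (fun ω => (X n ω, Y n ω)) P)
    (hX : ∀ n, P.map (X n) = μ) (hY : ∀ n, P.map (Y n) = ν)
    (hcov : ∀ a b : E,
      Tendsto (fun n => cov[fun ω => ⟪a, X n ω⟫, fun ω => ⟪b, Y n ω⟫; P]) atTop (𝓝 0))
    (f g : E →ᵇ ℝ) :
    Tendsto (fun n => ∫ ω, f (X n ω) * g (Y n ω) ∂P) atTop
      (𝓝 ((∫ x, f x ∂μ) * ∫ y, g y ∂ν)) := by
  have := (hXY 0).isProbabilityMeasure
  have hXm n : AEMeasurable (X n) P := (hXY n).fst.aemeasurable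
  have hYm n : AEMeasurable (Y n) P := (hXY n).snd.aemeasurable
  have : IsProbabilityMeasure μ := hX 0 ▸ Measure.isProbabilityMeasure_map (hXm 0)
  have : IsProbabilityMeasure ν := hY 0 ▸ Measure.isProbabilityMeasure_map (hYm 0)
  have hpair n : AEMeasurable (fun ω => WithLp.toLp 2 (X n ω, Y n ω)) P :=
    ((hXY n).toLp_prodMk 2).aemeasurable
  have htoLp : Measurable (WithLp.toLp 2 : E × E → WithLp 2 (E × E)) :=
    (MeasurableEquiv.toLp 2 (E × E)).measurable
  let ξ (n : ℕ) : ProbabilityMeasure (WithLp 2 (E × E)) :=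
    ⟨P.map fun ω => WithLp.toLp 2 (X n ω, Y n ω), Measure.isProbabilityMeasure_map (hpair n)⟩
  let ξ₀ : ProbabilityMeasure (WithLp 2 (E × E)) :=
    ⟨(μ.prod ν).map (WithLp.toLp 2), Measure.isProbabilityMeasure_map htoLp.aemeasurable⟩
  have hξ : Tendsto ξ atTop (𝓝 ξ₀) := by
    refine ProbabilityMeasure.tendsto_of_tendsto_charFun fun t => ?_
    have hlim : Tendsto (fun n => charFun μ t.fst * charFun ν t.snd *
        Complex.exp (-(cov[fun ω => ⟪t.fst, X n ω⟫, fun ω => ⟪t.snd, Y n ω⟫; P] : ℝ)))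
        atTop (𝓝 (charFun μ t.fst * charFun ν t.snd * Complex.exp (-((0 : ℝ) : ℂ)))) :=
      ((Complex.continuous_exp.comp
        (continuous_neg.comp Complex.continuous_ofReal)).continuousAt.tendsto.comp
          (hcov t.fst t.snd)).const_mul _
    simp only [ξ, ξ₀, ProbabilityMeasure.coe_mk, charFun_prod]
    simp only [Complex.ofReal_zero, neg_zero, Complex.exp_zero, mul_one] at hlim
    refine hlim.congr fun n => ?_
    rw [(hXY n).charFun_map_toLp_prodMk, hX, hY]
  let h : WithLp 2 (E × E) →ᵇ ℝ :=
    f.compContinuous ⟨fun z => z.fst, by fun_prop⟩ * g.compContinuous ⟨fun z => z.snd, by fun_prop⟩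
  have hconv := ProbabilityMeasure.tendsto_iff_forall_integral_tendsto.1 hξ h
  have hlim : ∫ z, h z ∂(ξ₀ : Measure (WithLp 2 (E × E))) =
      (∫ x, f x ∂μ) * ∫ y, g y ∂ν := by
    rw [← integral_prod_mul]
    exact integral_map htoLp.aemeasurable h.continuous.aestronglyMeasurable
  rw [hlim] at hconv
  refine hconv.congr fun n => ?_
  exact integral_map (hpair n) h.continuous.aestronglyMeasurable

open scoped RealInnerProductSpace in
lemma IsCovarianceFunction.covariance_inner {Ω : Type*} [MeasurableSpace Ω] {P : Measure Ω}
    [IsFiniteMeasure P] {ℓ : ℕ}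
    {H : EuclideanSpace ℝ (Fin 2) → Ω → EuclideanSpace ℝ (Fin ℓ)}
    {C : EuclideanSpace ℝ (Fin 2) → Matrix (Fin ℓ) (Fin ℓ) ℝ} (hC : IsCovarianceFunction H P C)
    (hH : ∀ s, MemLp (H s) 2 P) (p q : EuclideanSpace ℝ (Fin 2)) (a b : EuclideanSpace ℝ (Fin ℓ)) :
    cov[fun ω => ⟪a, H p ω⟫, fun ω => ⟪b, H q ω⟫; P] =
      ∑ i, ∑ j, a i * b j * C (q - p) i j := by
  have hcoord s i : MemLp (fun ω => H s ω i) 2 P :=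
    (hH s).continuousLinearMap_comp (EuclideanSpace.proj (𝕜 := ℝ) i)
  simp only [PiLp.inner_apply, RCLike.inner_apply, conj_trivial]
  rw [covariance_fun_sum_fun_sum (fun i => (hcoord p i).mul_const _)
    (fun j => (hcoord q j).mul_const _)]
  refine Finset.sum_congr rfl fun i _ => Finset.sum_congr rfl fun j _ => ?_
  rw [covariance_mul_const_left, covariance_mul_const_right, hC p (q - p), add_sub_cancel]
  ring

open scoped BoundedContinuousFunction in
/-- For a stationary Gaussian field with vanishing covariances at infinity, bounded continuous
observables decorrelate uniformly in the distance. -/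
lemma exists_norm_le_imp_abs_integral_mul_sub_le {Ω : Type*} [MeasurableSpace Ω] {P : Measure Ω}
    [IsProbabilityMeasure P] {ℓ : ℕ}
    {H : EuclideanSpace ℝ (Fin 2) → Ω → EuclideanSpace ℝ (Fin ℓ)}
    (hgauss : IsGaussianProcess H P) (hstat : IsStationaryField H P)
    {C : EuclideanSpace ℝ (Fin 2) → Matrix (Fin ℓ) (Fin ℓ) ℝ} (hC : IsCovarianceFunction H P C)
    (hC_lim : ∀ i j : Fin ℓ, Tendsto (fun h => C h i j)
      (comap (fun h : EuclideanSpace ℝ (Fin 2) => ‖h‖) atTop) (𝓝 0))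
    (g : EuclideanSpace ℝ (Fin ℓ) →ᵇ ℝ) {ε : ℝ} (hε : 0 < ε) :
    ∃ R : ℝ, ∀ p q, R ≤ ‖q - p‖ →
      |∫ ω, g (H p ω) * g (H q ω) ∂P - (∫ x, g x ∂P.map (H 0)) ^ 2| ≤ ε := by
  -- Failure for every `R = n` yields pairs of locations whose lags escape to infinity,
  -- contradicting the sequential limit.
  by_contra! hcon
  choose p q hpq hbad using fun n : ℕ => hcon n
  have hnorm : Tendsto (fun n => q n - p n) atTop
      (comap (fun h : EuclideanSpace ℝ (Fin 2) => ‖h‖) atTop) :=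
    tendsto_comap_iff.2 (tendsto_atTop_mono hpq tendsto_natCast_atTop_atTop)
  have hm := hgauss.aemeasurable
  have hlim := tendsto_integral_mul_of_hasGaussianLaw (X := fun n => H (p n))
    (Y := fun n => H (q n)) (fun n => hgauss.hasGaussianLaw_prodMk)
    (fun n => hstat.map_eq hm _) (fun n => hstat.map_eq hm _) (fun a b => by
      simp_rw [hC.covariance_inner (fun s => (hgauss.hasGaussianLaw_eval s).memLp_two)]
      have := tendsto_finsetSum Finset.univ fun i _ => tendsto_finsetSum Finset.univ fun j _ =>
        ((hC_lim i j).comp hnorm).const_mul (a i * b j)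
      simpa using this) g g
  rw [← sq] at hlim
  obtain ⟨n, hn⟩ := ((Metric.tendsto_atTop.1 hlim ε hε))
  exact absurd (hn n le_rfl) (not_lt.2 (by rw [Real.dist_eq]; exact (hbad n).le))

-- Centring turns the mixed moments into covariances, which `hlag` bounds.
open scoped BoundedContinuousFunction in
lemma tendsto_eLpNorm_one_average_sub_integral {Ω E : Type*} [MeasurableSpace Ω]
    {P : Measure Ω} [IsProbabilityMeasure P] [TopologicalSpace E] [MeasurableSpace E]
    [BorelSpace E] {μ : Measure E} {Y : ℕ → Ω → E} (hY : ∀ k, AEMeasurable (Y k) P)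
    (hμ : ∀ k, P.map (Y k) = μ) (g : E →ᵇ ℝ)
    (hlag : ∀ ε > 0, ∃ N : ℕ, ∀ k l, k + N ≤ l →
      |∫ ω, g (Y k ω) * g (Y l ω) ∂P - (∫ x, g x ∂μ) ^ 2| ≤ ε) :
    Tendsto (fun n : ℕ => eLpNorm
      (fun ω => (1 / (n : ℝ)) * ∑ i ∈ Finset.range n, (g (Y i ω) - ∫ x, g x ∂μ)) 1 P)
      atTop (𝓝 0) := by
  have : IsProbabilityMeasure μ := hμ 0 ▸ Measure.isProbabilityMeasure_map (hY 0)
  have hmeas k : AEStronglyMeasurable (fun ω => g (Y k ω)) P :=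
    (g.continuous.measurable.comp_aemeasurable (hY k)).aestronglyMeasurable
  have hmem k : MemLp (fun ω => g (Y k ω)) 2 P :=
    MemLp.of_bound (hmeas k) ‖g‖ (ae_of_all _ fun ω => g.norm_coe_le_norm _)
  have hmean k : ∫ ω, g (Y k ω) ∂P = ∫ x, g x ∂μ := by
    rw [← hμ k, integral_map (hY k) g.continuous.measurable.aestronglyMeasurable]
  refine tendsto_eLpNorm_one_average_of_integral_mul_le
    (X := fun k ω => g (Y k ω) - ∫ x, g x ∂μ) (fun k => (hmeas k).sub aestronglyMeasurable_const)
    (B := ‖g‖ + ‖∫ x, g x ∂μ‖)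
    (fun k ω => (norm_sub_le _ _).trans (add_le_add (g.norm_coe_le_norm _) le_rfl)) fun ε hε => ?_
  obtain ⟨N, hN⟩ := hlag ε hε
  refine ⟨N, fun k l hkl => ?_⟩
  convert hN k l hkl using 2
  have := covariance_eq_sub (hmem k) (hmem l)
  simp only [covariance, hmean, Pi.mul_apply] at this
  rw [this, sq]

/-! ### From bounded continuous to integrable observables. -/

open scoped BoundedContinuousFunction ENNReal in
/-- If the averages of bounded continuous observables of identically distributed variables converge
in `L¹`, then so do the averages of all integrable observables. -/
lemma tendsto_eLpNorm_one_average_sub_of_boundedContinuous {Ω E : Type*} [MeasurableSpace Ω]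
    {P : Measure Ω} [IsProbabilityMeasure P] [TopologicalSpace E] [NormalSpace E]
    [MeasurableSpace E] [BorelSpace E] {μ : Measure E} [μ.WeaklyRegular] {Y : ℕ → Ω → E}
    (hY : ∀ k, AEMeasurable (Y k) P) (hμ : ∀ k, P.map (Y k) = μ)
    (hg : ∀ g : E →ᵇ ℝ, Tendsto (fun n : ℕ => eLpNorm
      (fun ω => (1 / (n : ℝ)) * ∑ i ∈ Finset.range n, (g (Y i ω) - ∫ x, g x ∂μ)) 1 P)
      atTop (𝓝 0))
    {φ : E → ℝ} (hφm : Measurable φ) (hφ : Integrable φ μ) :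
    Tendsto (fun n : ℕ => eLpNorm
      (fun ω => (1 / (n : ℝ)) * ∑ i ∈ Finset.range n, (φ (Y i ω) - ∫ x, φ x ∂μ)) 1 P)
      atTop (𝓝 0) := by
  have : IsProbabilityMeasure μ := hμ 0 ▸ Measure.isProbabilityMeasure_map (hY 0)
  rw [ENNReal.tendsto_nhds_zero]
  intro ε hε
  have hε3 : ε / 3 ≠ 0 := (ENNReal.div_pos hε.ne' (by simp)).ne'
  obtain ⟨g, hgφ, hgint⟩ := hφ.exists_boundedContinuous_lintegral_sub_le hε3
  filter_upwards [ENNReal.tendsto_nhds_zero.1 (hg g) (ε / 3) (pos_iff_ne_zero.2 hε3)] with n hn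
  have hgm : Measurable g := g.continuous.measurable
  have hterm (k : ℕ) : eLpNorm (fun ω => φ (Y k ω) - g (Y k ω)) 1 P ≤ ε / 3 := by
    rw [eLpNorm_one_eq_lintegral_enorm]
    rw [← hμ k, lintegral_map' (by fun_prop) (hY k)] at hgφ
    exact hgφ
  have hconst : eLpNorm (fun _ : Ω => ∫ x, g x ∂μ - ∫ x, φ x ∂μ) 1 P ≤ ε / 3 := by
    rw [eLpNorm_const _ one_ne_zero (NeZero.ne P), ← integral_sub hgint hφ]
    simp only [measure_univ, ENNReal.one_rpow, mul_one]
    refine (enorm_integral_le_lintegral_enorm _).trans (le_of_eq_of_le ?_ hgφ)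
    exact lintegral_congr fun x => by rw [← enorm_neg, neg_sub]
  have hφY k : AEStronglyMeasurable (fun ω => φ (Y k ω)) P :=
    (hφm.comp_aemeasurable (hY k)).aestronglyMeasurable
  have hgY k : AEStronglyMeasurable (fun ω => g (Y k ω)) P :=
    (hgm.comp_aemeasurable (hY k)).aestronglyMeasurable
  rcases Nat.eq_zero_or_pos n with rfl | hnpos
  · simp
  have hn0 : (n : ℝ) ≠ 0 := by positivity
  -- Sampling error, centred average of `g`, and difference of means: each costs at most `ε / 3`.
  have hsplit : (fun ω => (1 / (n : ℝ)) * ∑ i ∈ Finset.range n, (φ (Y i ω) - ∫ x, φ x ∂μ)) =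
      (fun ω => (1 / (n : ℝ)) * ∑ i ∈ Finset.range n, (φ (Y i ω) - g (Y i ω))) +
      (fun ω => (1 / (n : ℝ)) * ∑ i ∈ Finset.range n, (g (Y i ω) - ∫ x, g x ∂μ)) +
      fun _ => ∫ x, g x ∂μ - ∫ x, φ x ∂μ := by
    ext ω
    simp only [Pi.add_apply, Finset.sum_sub_distrib, Finset.sum_const, Finset.card_range,
      nsmul_eq_mul]
    field_simp
    ring
  have havg : eLpNorm (fun ω => (1 / (n : ℝ)) * ∑ i ∈ Finset.range n, (φ (Y i ω) - g (Y i ω))) 1 P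
      ≤ ε / 3 := by
    have hsum := eLpNorm_sum_le (μ := P) (p := 1) (s := Finset.range n)
      (f := fun i ω => φ (Y i ω) - g (Y i ω)) (fun i _ => (hφY i).sub (hgY i)) le_rfl
    have hsum' := hsum.trans (Finset.sum_le_sum fun i _ => hterm i)
    rw [Finset.sum_const, Finset.card_range, nsmul_eq_mul] at hsum'
    have hsmul := eLpNorm_const_smul (1 / (n : ℝ))
      (∑ i ∈ Finset.range n, fun ω => φ (Y i ω) - g (Y i ω)) 1 P
    have heq : (fun ω => (1 / (n : ℝ)) * ∑ i ∈ Finset.range n, (φ (Y i ω) - g (Y i ω))) =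
        (1 / (n : ℝ)) • ∑ i ∈ Finset.range n, fun ω => φ (Y i ω) - g (Y i ω) := by
      ext ω
      simp
    rw [heq, hsmul]
    calc _ ≤ ‖(1 / (n : ℝ))‖ₑ * (n * (ε / 3)) := by gcongr
      _ = ε / 3 := by
        have h1 : ‖(1 / (n : ℝ))‖ₑ * (n : ℝ≥0∞) = 1 := by
          rw [one_div, enorm_inv hn0, Real.enorm_natCast]
          exact ENNReal.inv_mul_cancel (by exact_mod_cast hnpos.ne') (by simp)
        rw [← mul_assoc, h1, one_mul]
  have hm1 : AEStronglyMeasurable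
      (fun ω => (1 / (n : ℝ)) * ∑ i ∈ Finset.range n, (φ (Y i ω) - g (Y i ω))) P :=
    (Finset.aestronglyMeasurable_fun_sum _ fun i _ => (hφY i).sub (hgY i)).const_mul _
  have hm2 : AEStronglyMeasurable
      (fun ω => (1 / (n : ℝ)) * ∑ i ∈ Finset.range n, (g (Y i ω) - ∫ x, g x ∂μ)) P :=
    (Finset.aestronglyMeasurable_fun_sum _ fun i _ =>
      (hgY i).sub aestronglyMeasurable_const).const_mul _
  rw [hsplit]
  calc _ ≤ _ := eLpNorm_add_le (hm1.add hm2) aestronglyMeasurable_const le_rfl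
    _ ≤ _ := add_le_add_left (eLpNorm_add_le hm1 hm2 le_rfl) _
    _ ≤ ε / 3 + ε / 3 + ε / 3 := by gcongr
    _ = ε := ENNReal.add_thirds ε

theorem proposition3 {Ω : Type*} [MeasurableSpace Ω] (P : Measure Ω) [IsProbabilityMeasure P]
    (ℓ : ℕ) (H : EuclideanSpace ℝ (Fin 2) → Ω → EuclideanSpace ℝ (Fin ℓ))
    (hgauss : IsGaussianProcess H P) (hstat : IsStationaryField H P)
    (C : EuclideanSpace ℝ (Fin 2) → Matrix (Fin ℓ) (Fin ℓ) ℝ)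
    (hC : IsCovarianceFunction H P C)
    (hC_lim : ∀ i j : Fin ℓ, Tendsto (fun h => C h i j)
      (comap (fun h : EuclideanSpace ℝ (Fin 2) => ‖h‖) atTop) (𝓝 0))
    (m : ℕ) (x : ℕ → ℝ) (y : Fin m → ℝ) (s : ℕ → EuclideanSpace ℝ (Fin 2))
    (hs : IsRegularGridSampling m x y s) :
    SatisfiesLLN H s P := by
  intro φ hφm hφ
  have hm := hgauss.aemeasurable
  have hφY k : AEStronglyMeasurable (fun ω => φ (H (s k) ω)) P :=
    (hφm.comp_aemeasurable (hm _)).aestronglyMeasurable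
  have hmean : ∫ z, φ z ∂P.map (H 0) = ∫ ω, φ (H 0 ω) ∂P :=
    integral_map (hm 0) hφm.aestronglyMeasurable
  have hφ' : Integrable φ (P.map (H 0)) :=
    (integrable_map_measure hφm.aestronglyMeasurable (hm 0)).2 hφ
  have hlim := tendsto_eLpNorm_one_average_sub_of_boundedContinuous (Y := fun k => H (s k))
    (fun k => hm (s k)) (fun k => hstat.map_eq hm (s k))
    (fun g => tendsto_eLpNorm_one_average_sub_integral (fun k => hm (s k))
      (fun k => hstat.map_eq hm (s k)) g fun ε hε => by
        obtain ⟨R, hR⟩ :=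
          exists_norm_le_imp_abs_integral_mul_sub_le hgauss hstat hC hC_lim g hε
        obtain ⟨N, hN⟩ := hs.exists_lag_le_norm_sub R
        exact ⟨N, fun k l hkl => hR _ _ (hN k l hkl)⟩) hφm hφ'
  rw [hmean] at hlim
  refine tendstoInMeasure_of_tendsto_eLpNorm one_ne_zero
    (fun n => (Finset.aestronglyMeasurable_fun_sum _ fun i _ => hφY i).const_mul _)
    aestronglyMeasurable_const (hlim.congr' ?_)
  -- At `n = 0` the average is 0 by convention, so centring inside and outside the sum can differ.
  filter_upwards [eventually_gt_atTop 0] with n hn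
  have hn0 : (n : ℝ) ≠ 0 := by positivity
  congr 1
  ext ω
  simp only [Pi.sub_apply, Finset.sum_sub_distrib, Finset.sum_const, Finset.card_range,
    nsmul_eq_mul]
  field_simp
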